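/- Let $B$ be a unital $\mathrm{C}^*$-algebra and let $A\subset B$ be a norm-closed subalgebra containing the unit of $B$. A state on $B$ is a linear functional $\psi:B\to\mathbb{C}$ with $\|\psi\|\le 1$ and $\psi(1)=1$; it is pure if it is an extreme point of the convex set of all states on $B$. A state $\psi$ on $B$ is $A$-convex if, for every $a\in A$, the function $t\mapsto \psi(e^{ta^*}e^{ta})$ is convex on $[0,\infty)$. Let $\operatorname{spec}(B)$ be the set of unitary equivalence classes of irreducible $*$-representations of $B$ on non-zero Hilbert spaces, with its usual (hull-kernel) topology: a set $K\subset\operatorname{spec}(B)$ is closed if and only if it contains the class of every irreducible $*$-representation $\sigma$ with $\bigcap_{[\pi]\in K}\ker\pi\subset\ker\sigma$. Let $\omega$ be a pure state on $B$ whose restriction to $A$ admits a unique state extension to $B$, and assume that $\omega$ is $A$-convex. Let $K\subset\operatorname{spec}(B)$ be a closed subset not containing the class of the GNS representation of $\omega$. Then, for every $\alpha>0$, there is an element $a\in A$, invertible in $A$, with $\|a\|\le 1+\alpha$ and $\omega(a^*a)=1$, while $\|\pi(a)\|<\alpha$ for every irreducible $*$-representation $\pi$ of $B$ whose class lies in $K$.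 -/

import Mathlib

open scoped ComplexOrder InnerProductSpace

universe u

namespace CStarSpec

/-! ### States -/

section States

variable (B : Type u) [CStarAlgebra B]

/-- The state space of the unital C*-algebra `B`: all unital contractive linear functionals. -/
def stateSpace : Set (B →L[ℂ] ℂ) := {φ | ‖φ‖ ≤ 1 ∧ φ 1 = 1}

/-- The pure states: the extreme points of the convex set of all states. -/
def pureStates : Set (B →L[ℂ] ℂ) := (stateSpace B).extremePoints ℝ

variable {B}

/-- A functional `ψ` is `X`-convex if `t ↦ ψ (e^{ta*} e^{ta})` is convex on `[0, ∞)` for every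
`a ∈ X`. (For a state `ψ` these values are non-negative real numbers.) -/
def IsConvexOver (X : Set B) (ψ : B →L[ℂ] ℂ) : Prop :=
  ∀ a ∈ X, ConvexOn ℝ (Set.Ici (0 : ℝ)) fun t : ℝ =>
    (ψ (NormedSpace.exp ((t : ℂ) • star a) * NormedSpace.exp ((t : ℂ) • a))).re

/-- `ψ` is the only state on `B` that extends the restriction of `ψ` to `X`. -/
def HasUniqueStateExtension (X : Set B) (ψ : B →L[ℂ] ℂ) : Prop :=
  ∀ φ ∈ stateSpace B, (∀ a ∈ X, φ a = ψ a) → φ = ψ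

theorem im_eq_zero_of_mem_stateSpace {φ : B →L[ℂ] ℂ} (hφ : φ ∈ stateSpace B) {a : B}
    (ha : IsSelfAdjoint a) : (φ a).im = 0 := by
  have key : ∀ t : ℝ, ((φ a).im + t) ^ 2 ≤ ‖a‖ ^ 2 + t ^ 2 * ‖(1 : B)‖ := by
    intro t
    set c : B := a + ((t : ℂ) * Complex.I) • (1 : B) with hc
    have h1 : ‖φ c‖ ≤ ‖c‖ := by simpa using φ.le_of_opNorm_le hφ.1 c
    have h2 : star c * c = a * a + ((t : ℂ) ^ 2) • (1 : B) := by
      have : (Complex.I * Complex.I) = -1 := Complex.I_mul_I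
      simp only [hc, star_add, star_smul, ha.star_eq, star_one, add_mul, mul_add, smul_mul_assoc,
        mul_smul_comm, one_mul, mul_one, smul_add, smul_smul, Complex.star_def, map_mul, Complex.conj_ofReal,
        Complex.conj_I]
      have h3 : (t : ℂ) * -Complex.I * ((t : ℂ) * Complex.I) = (t : ℂ) ^ 2 := by
        linear_combination (-(t : ℂ) ^ 2) * this
      have h3' : (t : ℂ) * Complex.I * ((t : ℂ) * -Complex.I) = (t : ℂ) ^ 2 := by
        rw [← h3]; ring
      rw [h3']
      have h4 : ((t : ℂ) * -Complex.I) • a = - (((t : ℂ) * Complex.I) • a) := by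
        rw [← neg_smul]; ring_nf
      rw [h4]; abel
    have h3 : ‖c‖ ^ 2 ≤ ‖a‖ ^ 2 + t ^ 2 * ‖(1 : B)‖ := by
      rw [sq, ← CStarRing.norm_star_mul_self, h2]
      refine (norm_add_le _ _).trans (add_le_add ?_ ?_)
      · rw [sq]; exact norm_mul_le _ _
      · rw [norm_smul]; simp
    have h4 : (φ c).im = (φ a).im + t := by
      simp [hc, hφ.2]
    have h5 : (φ c).im ^ 2 ≤ ‖φ c‖ ^ 2 := by
      rw [← sq_abs]; gcongr; exact Complex.abs_im_le_norm _
    have h6 : ‖φ c‖ ^ 2 ≤ ‖c‖ ^ 2 := by gcongr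
    rw [← h4]; linarith
  have hn : ‖(1 : B)‖ ≤ 1 := by
    rcases subsingleton_or_nontrivial B with h | h
    · simp [Subsingleton.elim (1 : B) 0]
    · simp
  by_contra hy
  have := key ((‖a‖ ^ 2 + 1) / (2 * (φ a).im))
  set t := (‖a‖ ^ 2 + 1) / (2 * (φ a).im) with ht
  have h7 : 2 * (φ a).im * t = ‖a‖ ^ 2 + 1 := by
    rw [ht]; field_simp
  nlinarith [sq_nonneg t, sq_nonneg (φ a).im, mul_le_mul_of_nonneg_left hn (sq_nonneg t)]

variable [PartialOrder B] [StarOrderedRing B]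

theorem nonneg_of_mem_stateSpace {φ : B →L[ℂ] ℂ} (hφ : φ ∈ stateSpace B) {a : B}
    (ha : 0 ≤ a) : 0 ≤ φ a := by
  have him := im_eq_zero_of_mem_stateSpace hφ (IsSelfAdjoint.of_nonneg ha)
  have h1 : ‖algebraMap ℝ B ‖a‖ - a‖ ≤ ‖a‖ := by
    have hle : a ≤ algebraMap ℝ B ‖a‖ := IsSelfAdjoint.le_algebraMap_norm_self (.of_nonneg ha)
    rw [CStarAlgebra.norm_le_iff_le_algebraMap _ (norm_nonneg a) (sub_nonneg.2 hle)]
    exact sub_le_self _ ha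
  have h2 : ‖φ (algebraMap ℝ B ‖a‖ - a)‖ ≤ ‖a‖ := by
    refine le_trans ?_ h1
    simpa using φ.le_of_opNorm_le hφ.1 (algebraMap ℝ B ‖a‖ - a)
  have h3 : φ (algebraMap ℝ B ‖a‖) = (‖a‖ : ℂ) := by
    have : algebraMap ℝ B ‖a‖ = (‖a‖ : ℂ) • (1 : B) := by
      rw [Algebra.algebraMap_eq_smul_one]; simp
    rw [this, map_smul, hφ.2]; simp
  rw [map_sub, h3] at h2
  have h4 := (Complex.re_le_norm _).trans h2
  simp only [Complex.sub_re, Complex.ofReal_re] at h4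
  rw [Complex.nonneg_iff]
  exact ⟨by linarith, him.symm⟩

/-- A state as a positive linear functional. -/
noncomputable def toPositive (φ : B →L[ℂ] ℂ) (hφ : φ ∈ stateSpace B) : B →ₚ[ℂ] ℂ :=
  PositiveLinearMap.mk₀ (φ : B →ₗ[ℂ] ℂ) fun _ hx => nonneg_of_mem_stateSpace hφ hx

end States

/-! ### Irreducible representations -/

section Representations

variable {B : Type u} [CStarAlgebra B]

/-- A unital *-representation on a Hilbert space is irreducible if the space is nonzero and the only
closed invariant subspaces are `0` and the whole space. -/
def IsIrreducibleRep {H : Type*} [NormedAddCommGroup H] [InnerProductSpace ℂ H] [CompleteSpace H]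
    (π : B →⋆ₐ[ℂ] (H →L[ℂ] H)) : Prop :=
  Nontrivial H ∧ ∀ V : Submodule ℂ H, IsClosed (V : Set H) →
    (∀ b : B, ∀ v ∈ V, π b v ∈ V) → V = ⊥ ∨ V = ⊤

variable (B) in
/-- The irreducible *-representations of `B`. (Their spaces are quotients of `B`, so that every
irreducible representation is equivalent to one on a Hilbert space in the universe of `B`.) -/
structure IrrRep : Type (u + 1) where
  /-- the Hilbert space -/
  H : Type u
  [instNACG : NormedAddCommGroup H]
  [instIPS : InnerProductSpace ℂ H]
  [instComplete : CompleteSpace H]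
  /-- the representation -/
  rep : B →⋆ₐ[ℂ] (H →L[ℂ] H)
  irreducible : IsIrreducibleRep rep

attribute [instance] IrrRep.instNACG IrrRep.instIPS IrrRep.instComplete

/-- Unitary equivalence of irreducible representations. -/
def UnitarilyEquivalent (π ρ : IrrRep B) : Prop :=
  ∃ U : π.H ≃ₗᵢ[ℂ] ρ.H, ∀ (b : B) (v : π.H), U (π.rep b v) = ρ.rep b (U v)

instance IrrRep.setoid : Setoid (IrrRep B) where
  r := UnitarilyEquivalent
  iseqv :=
    { refl := fun π => ⟨LinearIsometryEquiv.refl ℂ π.H, fun _ _ => rfl⟩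
      symm := by
        rintro π ρ ⟨U, hU⟩
        refine ⟨U.symm, fun b v => ?_⟩
        apply U.injective
        rw [hU]; simp
      trans := by
        rintro π ρ σ ⟨U, hU⟩ ⟨W, hW⟩
        refine ⟨U.trans W, fun b v => ?_⟩
        simp [hU, hW] }

variable (B) in
/-- The spectrum of `B`: the unitary equivalence classes of irreducible *-representations. -/
def Spec : Type (u + 1) := Quotient (IrrRep.setoid (B := B))

/-- The class of an irreducible representation. -/
def Spec.mk (π : IrrRep B) : Spec B := Quotient.mk IrrRep.setoid π

theorem UnitarilyEquivalent.rep_eq_zero {π ρ : IrrRep B} (h : UnitarilyEquivalent π ρ) {b : B}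
    (hb : π.rep b = 0) : ρ.rep b = 0 := by
  obtain ⟨U, hU⟩ := h
  ext v
  have := hU b (U.symm v)
  rw [hb] at this
  simpa using this.symm

/-- The (primitive) ideal of `B` attached to a point of the spectrum: the kernel of any
representation in the class. -/
def Spec.ker (p : Spec B) : Set B :=
  Quotient.lift (fun π : IrrRep B => {b : B | π.rep b = 0}) (by
    intro π ρ h
    ext b
    exact ⟨fun hb => UnitarilyEquivalent.rep_eq_zero h hb,
      fun hb => UnitarilyEquivalent.rep_eq_zero (IrrRep.setoid.symm h) hb⟩) p

/-- The hull-kernel closure of a set of points of the spectrum. -/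
def hullKer (K : Set (Spec B)) : Set (Spec B) := {p | ⋂ q ∈ K, q.ker ⊆ p.ker}

theorem hullKer_union (K L : Set (Spec B)) : hullKer (K ∪ L) ⊆ hullKer K ∪ hullKer L := by
  intro p hp
  by_contra hn
  simp only [Set.mem_union, not_or] at hn
  obtain ⟨hK, hL⟩ := hn
  obtain ⟨b, hbK, hb⟩ := Set.not_subset.1 hK
  obtain ⟨c, hcL, hc⟩ := Set.not_subset.1 hL
  obtain ⟨π, rfl⟩ := Quotient.exists_rep p
  have hb : π.rep b ≠ 0 := hb
  have hc : π.rep c ≠ 0 := hc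
  have hprod : ∀ x : B, π.rep (b * x * c) = 0 := by
    intro x
    apply hp
    simp only [Set.mem_iInter] at hbK hcL ⊢
    rintro q (hq | hq)
    · have := hbK q hq
      obtain ⟨ρ, rfl⟩ := Quotient.exists_rep q
      have this : ρ.rep b = 0 := this
      change ρ.rep (b * x * c) = 0
      simp [this]
    · have := hcL q hq
      obtain ⟨ρ, rfl⟩ := Quotient.exists_rep q
      have this : ρ.rep c = 0 := this
      change ρ.rep (b * x * c) = 0
      simp [this]
  let V : Submodule ℂ π.H := ⨅ x : B, LinearMap.ker ((π.rep b * π.rep x : π.H →L[ℂ] π.H) : π.H →ₗ[ℂ] π.H)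
  have hV : ∀ v, v ∈ V ↔ ∀ x : B, π.rep b (π.rep x v) = 0 := by
    intro v
    simp [V, Submodule.mem_iInf]
  have hclosed : IsClosed (V : Set π.H) := by
    simp only [V, Submodule.coe_iInf]
    exact isClosed_iInter fun x => (π.rep b * π.rep x).isClosed_ker
  have hinv : ∀ a : B, ∀ v ∈ V, π.rep a v ∈ V := by
    intro a v hv
    rw [hV] at hv ⊢
    intro x
    have := hv (x * a)
    simpa using this
  rcases π.irreducible.2 V hclosed hinv with h | h
  · apply hc
    ext v
    have : π.rep c v ∈ V := by
      rw [hV]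
      intro x
      have := DFunLike.congr_fun (hprod x) v
      simpa using this
    rw [h] at this
    simpa using this
  · apply hb
    ext v
    have : v ∈ V := h ▸ Submodule.mem_top
    have := (hV v).1 this 1
    simpa using this

/-- The usual (Jacobson, or hull-kernel) topology on the spectrum: `K` is closed if it contains
every `p` whose kernel contains the intersection of the kernels of the elements of `K`. -/
instance Spec.topologicalSpace : TopologicalSpace (Spec B) :=
  TopologicalSpace.ofClosed {K | hullKer K ⊆ K}
    (by
      intro p hp
      obtain ⟨π, rfl⟩ := Quotient.exists_rep p
      have h1 : π.rep 1 = 0 := hp (by simp)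
      obtain ⟨v, hv⟩ := @exists_ne _ π.irreducible.1 (0 : π.H)
      exact hv (by simpa using DFunLike.congr_fun h1 v))
    (by
      intro S hS p hp K hK
      refine hS hK fun b hb => hp ?_
      simp only [Set.mem_iInter] at hb ⊢
      exact fun q hq => hb q (hq K hK))
    (by
      intro K hK L hL
      exact (hullKer_union K L).trans (Set.union_subset_union hK hL))

end Representations

/-! ### The class of the GNS representation of a pure state -/

section GNS

variable {B : Type u} [CStarAlgebra B] [PartialOrder B] [StarOrderedRing B]

/-- The GNS representation of a state. -/
noncomputable def gnsRep (φ : B →L[ℂ] ℂ) (hφ : φ ∈ stateSpace B) :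
    B →⋆ₐ[ℂ] ((toPositive φ hφ).GNS →L[ℂ] (toPositive φ hφ).GNS) :=
  (toPositive φ hφ).gnsStarAlgHom

/-- The cyclic vector of the GNS representation. -/
noncomputable def gnsVector (φ : B →L[ℂ] ℂ) (hφ : φ ∈ stateSpace B) : (toPositive φ hφ).GNS :=
  (((toPositive φ hφ).toPreGNS 1 : (toPositive φ hφ).PreGNS) : (toPositive φ hφ).GNS)

theorem gnsRep_gnsVector (φ : B →L[ℂ] ℂ) (hφ : φ ∈ stateSpace B) (b : B) :
    gnsRep φ hφ b (gnsVector φ hφ) =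
      (((toPositive φ hφ).toPreGNS b : (toPositive φ hφ).PreGNS) : (toPositive φ hφ).GNS) := by
  change (toPositive φ hφ).gnsNonUnitalStarAlgHom b _ = _
  rw [gnsVector, PositiveLinearMap.gnsNonUnitalStarAlgHom_apply_coe]
  simp

theorem inner_gnsVector (φ : B →L[ℂ] ℂ) (hφ : φ ∈ stateSpace B) (b : B) :
    ⟪gnsVector φ hφ, gnsRep φ hφ b (gnsVector φ hφ)⟫_ℂ = φ b := by
  rw [gnsRep_gnsVector, gnsVector, UniformSpace.Completion.inner_coe,
    PositiveLinearMap.preGNS_inner_def]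
  rw [PositiveLinearMap.ofPreGNS_toPreGNS, PositiveLinearMap.ofPreGNS_toPreGNS, star_one, one_mul]
  rfl

theorem gns_cyclic (φ : B →L[ℂ] ℂ) (hφ : φ ∈ stateSpace B)
    (V : Submodule ℂ (toPositive φ hφ).GNS) (hV : IsClosed (V : Set (toPositive φ hφ).GNS))
    (h : ∀ b, gnsRep φ hφ b (gnsVector φ hφ) ∈ V) : V = ⊤ := by
  rw [eq_top_iff]
  rintro v -
  induction v using UniformSpace.Completion.induction_on with
  | hp => exact hV
  | ih x =>
    have := h ((toPositive φ hφ).ofPreGNS x)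
    rwa [gnsRep_gnsVector, PositiveLinearMap.toPreGNS_ofPreGNS] at this

/-- The vector functional `b ↦ ⟪v, π(b) v⟫ / ‖v‖²` of a nonzero vector `v` is a state. -/
theorem exists_vectorState {H : Type*} [NormedAddCommGroup H] [InnerProductSpace ℂ H]
    [CompleteSpace H] (π : B →⋆ₐ[ℂ] (H →L[ℂ] H)) {v : H} (hv : v ≠ 0) :
    ∃ ψ ∈ stateSpace B, ∀ b, ((‖v‖ : ℂ) ^ 2) * ψ b = ⟪v, π b v⟫_ℂ := by
  have hn : (‖v‖ : ℂ) ≠ 0 := by simpa using hv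
  have hn' : 0 < ‖v‖ := norm_pos_iff.2 hv
  let l : B →ₗ[ℂ] ℂ :=
    { toFun := fun b => ((‖v‖ : ℂ) ^ 2)⁻¹ * ⟪v, π b v⟫_ℂ
      map_add' := fun a b => by simp [mul_add]
      map_smul' := fun c b => by simp; ring }
  have hl : ∀ b, ‖l b‖ ≤ 1 * ‖b‖ := by
    intro b
    have h1 : ‖⟪v, π b v⟫_ℂ‖ ≤ ‖v‖ ^ 2 * ‖b‖ := by
      refine (norm_inner_le_norm _ _).trans ?_
      have h2 : ‖π b v‖ ≤ ‖b‖ * ‖v‖ :=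
        ((π b).le_opNorm v).trans
          (mul_le_mul_of_nonneg_right (NonUnitalStarAlgHom.norm_apply_le π b) (norm_nonneg v))
      nlinarith
    have h3 : ‖l b‖ = (‖v‖ ^ 2)⁻¹ * ‖⟪v, π b v⟫_ℂ‖ := by
      simp [l]
    rw [h3, one_mul, inv_mul_le_iff₀ (by positivity)]
    exact h1
  refine ⟨l.mkContinuous 1 hl, ⟨l.mkContinuous_norm_le zero_le_one hl, ?_⟩, fun b => ?_⟩
  · simp [l, inner_self_eq_norm_sq_to_K, hn]
  · simp [l, hn]

/-- A representation with a cyclic vector that implements a pure state is irreducible. -/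
theorem irreducible_of_pure {φ : B →L[ℂ] ℂ} (hφ : φ ∈ pureStates B) {H : Type*}
    [NormedAddCommGroup H] [InnerProductSpace ℂ H] [CompleteSpace H]
    (π : B →⋆ₐ[ℂ] (H →L[ℂ] H)) (ξ : H) (hin : ∀ b, ⟪ξ, π b ξ⟫_ℂ = φ b)
    (hcyc : ∀ V : Submodule ℂ H, IsClosed (V : Set H) → (∀ b, π b ξ ∈ V) → V = ⊤) :
    IsIrreducibleRep π := by
  have hξ1 : ⟪ξ, ξ⟫_ℂ = 1 := by
    have := hin 1
    rw [hφ.1.2] at this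
    simpa using this
  have hξ0 : ξ ≠ 0 := by
    intro h
    rw [h] at hξ1
    simp at hξ1
  refine ⟨⟨ξ, 0, hξ0⟩, fun V hV hinv => ?_⟩
  have : CompleteSpace V := hV.completeSpace_coe
  have hinv' : ∀ b : B, ∀ w ∈ Vᗮ, π b w ∈ Vᗮ := by
    intro b w hw
    rw [Submodule.mem_orthogonal] at hw ⊢
    intro u hu
    have h1 := hw _ (hinv (star b) u hu)
    rw [map_star, ContinuousLinearMap.star_eq_adjoint, ContinuousLinearMap.adjoint_inner_left] at h1
    exact h1
  obtain ⟨v, hv, w, hw, hvw⟩ := Submodule.exists_add_mem_mem_orthogonal (K := V) ξ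
  have hort : ∀ b, ⟪v, π b w⟫_ℂ = 0 := fun b =>
    Submodule.inner_right_of_mem_orthogonal hv (hinv' b w hw)
  have hort' : ∀ b, ⟪w, π b v⟫_ℂ = 0 := fun b =>
    Submodule.inner_left_of_mem_orthogonal (hinv b v hv) hw
  by_cases hv0 : v = 0
  · left
    have htop : Vᗮ = ⊤ := by
      refine hcyc _ (Submodule.isClosed_orthogonal V) fun b => hinv' b _ ?_
      rw [hvw, hv0, zero_add]; exact hw
    exact (Submodule.orthogonal_eq_top_iff V).1 htop
  by_cases hw0 : w = 0
  · right
    refine hcyc _ hV fun b => hinv b _ ?_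
    rw [hvw, hw0, add_zero]; exact hv
  exfalso
  obtain ⟨ψ₁, hψ₁, h₁⟩ := exists_vectorState π hv0
  obtain ⟨ψ₂, hψ₂, h₂⟩ := exists_vectorState π hw0
  have hsum : ∀ b, φ b = (‖v‖ : ℂ) ^ 2 * ψ₁ b + (‖w‖ : ℂ) ^ 2 * ψ₂ b := by
    intro b
    rw [h₁, h₂, ← hin b, hvw, map_add, inner_add_left, inner_add_right, inner_add_right,
      hort, hort']
    ring
  have hone : ‖v‖ ^ 2 + ‖w‖ ^ 2 = 1 := by
    have := hsum 1
    rw [hφ.1.2, hψ₁.2, hψ₂.2, mul_one, mul_one] at this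
    exact_mod_cast this.symm
  have hvpos : 0 < ‖v‖ := norm_pos_iff.2 hv0
  have hwpos : 0 < ‖w‖ := norm_pos_iff.2 hw0
  have hseg : φ ∈ openSegment ℝ ψ₁ ψ₂ := by
    refine ⟨‖v‖ ^ 2, ‖w‖ ^ 2, by positivity, by positivity, hone, ?_⟩
    ext b
    rw [hsum b]
    simp
  have heq : ψ₁ = φ := hφ.2 hψ₁ hψ₂ hseg
  have hzero : ∀ b, ⟪v - ((‖v‖ : ℂ) ^ 2) • ξ, π b ξ⟫_ℂ = 0 := by
    intro b
    have h3 : ⟪v, π b ξ⟫_ℂ = ⟪v, π b v⟫_ℂ := by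
      rw [hvw, map_add, inner_add_right, hort, add_zero]
    rw [inner_sub_left, h3, inner_smul_left, hin, ← h₁, heq]
    simp
  have hperp : (ℂ ∙ (v - ((‖v‖ : ℂ) ^ 2) • ξ))ᗮ = ⊤ := by
    refine hcyc _ (Submodule.isClosed_orthogonal _) fun b => ?_
    rw [Submodule.mem_orthogonal_singleton_iff_inner_right]
    exact hzero b
  have hz : v - ((‖v‖ : ℂ) ^ 2) • ξ = 0 := by
    rw [Submodule.orthogonal_eq_top_iff] at hperp
    exact Submodule.span_singleton_eq_bot.1 hperp
  have hwz : ⟪w, v - ((‖v‖ : ℂ) ^ 2) • ξ⟫_ℂ = -(((‖v‖ : ℂ) ^ 2) * (‖w‖ : ℂ) ^ 2) := by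
    rw [inner_sub_right, inner_smul_right, hvw, inner_add_right]
    have := hort' 1
    simp only [map_one, one_apply_eq_self] at this
    rw [this, inner_self_eq_norm_sq_to_K]
    simp
  rw [hz, inner_zero_right] at hwz
  have hv' : (‖v‖ : ℂ) ≠ 0 := by simpa using hv0
  have hw' : (‖w‖ : ℂ) ≠ 0 := by simpa using hw0
  exact (neg_ne_zero.2 (mul_ne_zero (pow_ne_zero 2 hv') (pow_ne_zero 2 hw'))) hwz.symm

/-- The GNS representation of a pure state is irreducible. -/
theorem gnsRep_irreducible {φ : B →L[ℂ] ℂ} (hφ : φ ∈ pureStates B) :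
    IsIrreducibleRep (gnsRep φ hφ.1) :=
  irreducible_of_pure hφ _ (gnsVector φ hφ.1) (inner_gnsVector φ hφ.1) (gns_cyclic φ hφ.1)

/-- The class, in the spectrum, of the GNS representation of a pure state. -/
noncomputable def gnsClass (φ : B →L[ℂ] ℂ) (hφ : φ ∈ pureStates B) : Spec B :=
  Spec.mk ⟨(toPositive φ hφ.1).GNS, gnsRep φ hφ.1, gnsRep_irreducible hφ⟩

end GNS

end CStarSpec

/-!
The element `a` is a normalized exponential. Since `K` is closed and misses the class of the GNS
representation of `ω`, the ideal `J` of elements killed by all representations in `K` acts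
non-trivially, hence topologically cyclically, on the GNS space: some `j ∈ J` almost fixes the
cyclic vector (`exists_norm_sub_lt`). The element `G = -2N (1 - j)* (1 - j)` is then a well: it is
non-positive, `ω G` is almost `0`, and every representation in `K` maps it to `-2N`.

Uniqueness of the state extension of `ω` from `A` means, by the M. Riesz extension theorem, that
`ω G` is the supremum of the numbers `ω (f + f*)` with `f ∈ A` and `f + f* ≤ G`
(`HasUniqueStateExtension.exists_add_star_le`). For an `f` almost attaining it, `‖e^f‖ ≤ 1` and
`‖π (e^f)‖ ≤ e^{-N}` for `π` in `K`, because `‖e^f‖ ≤ e^c` whenever `f + f* ≤ 2c`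
(`norm_exp_le_of_add_star_le`). In general `ω (e^{f*} e^f)` is not controlled from below by
`ω (f + f*)`; here convexity of `t ↦ ω (e^{tf*} e^{tf})` gives
`ω (e^{f*} e^f) ≥ 1 + ω (f + f*)`, which is almost `1` (`IsConvexOver.one_add_le`). So
`a = e^f / √(ω (e^{f*} e^f))` has the required properties, its inverse being a multiple of `e^{-f}`.
-/

namespace CStarSpec

/-! ### Exponentials in C*-algebras -/

theorem hasDerivAt_exp_real_smul_zero {C : Type*} [CStarAlgebra C] (x : C) :
    HasDerivAt (fun t : ℝ => NormedSpace.exp (t • x)) x 0 := by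
  simpa using hasDerivAt_exp_smul_const (𝕂 := ℝ) x 0

open Filter Topology in
/-- The logarithmic norm estimate `‖e^f‖ ≤ e^c` when `Re f ≤ c`: it holds because
`‖1 + f / n‖ ≤ 1 + c / n + O(1 / n²)` and `e^f = (e^{f / n})^n`. -/
theorem norm_exp_le_of_add_star_le {C : Type*} [CStarAlgebra C] [PartialOrder C]
    [StarOrderedRing C] {f : C} {c : ℝ} (h : f + star f ≤ algebraMap ℝ C (2 * c)) :
    ‖NormedSpace.exp f‖ ≤ Real.exp c := by
  set M := ‖f‖ with hM
  have hone : ∀ t : ℝ, 0 ≤ t → 0 ≤ 1 + (t * c + t ^ 2 * M ^ 2 / 2) →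
      ‖1 + t • f‖ ≤ 1 + (t * c + t ^ 2 * M ^ 2 / 2) := by
    intro t ht h0
    refine (sq_le_sq₀ (norm_nonneg _) h0).1 ?_
    rw [sq, ← CStarRing.norm_star_mul_self]
    rw [CStarAlgebra.norm_le_iff_le_algebraMap _ (sq_nonneg _) (star_mul_self_nonneg _)]
    have h1 : star (1 + t • f) * (1 + t • f)
        = 1 + t • (f + star f) + t ^ 2 • (star f * f) := by
      simp only [star_add, star_one, star_smul, star_trivial, add_mul, mul_add, one_mul, mul_one,
        smul_mul_smul_comm, smul_add]
      rw [← sq]; abel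
    have h2 : star f * f ≤ algebraMap ℝ C (M ^ 2) := by
      refine (CStarAlgebra.norm_le_iff_le_algebraMap _ (sq_nonneg _)
        (star_mul_self_nonneg _)).1 ?_
      rw [CStarRing.norm_star_mul_self, sq]
    have h3 : star (1 + t • f) * (1 + t • f)
        ≤ algebraMap ℝ C (1 + t * (2 * c) + t ^ 2 * M ^ 2) := by
      rw [h1, map_add, map_add, map_mul _ t, map_mul _ (t ^ 2), map_one, ← Algebra.smul_def,
        ← Algebra.smul_def]
      exact add_le_add (add_le_add le_rfl (smul_le_smul_of_nonneg_left h ht))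
        (smul_le_smul_of_nonneg_left h2 (sq_nonneg t))
    refine h3.trans (algebraMap_mono C ?_)
    nlinarith [sq_nonneg (t * c + t ^ 2 * M ^ 2 / 2)]
  -- the remainder of the exponential series at `f / n` after the linear term is `o(1 / n)`
  set r : ℕ → ℝ := fun n => ‖NormedSpace.exp ((n : ℝ)⁻¹ • f) - 1
    - (n : ℝ)⁻¹ • f‖ with hr
  have hinv : Tendsto (fun n : ℕ => ((n : ℝ)⁻¹)) atTop (𝓝 0) := tendsto_inv_atTop_nhds_zero_nat
  have hrlim : Tendsto (fun n : ℕ => (n : ℝ) * r n) atTop (𝓝 0) := by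
    have hd := hasDerivAt_exp_real_smul_zero f
    rw [hasDerivAt_iff_isLittleO] at hd
    have h1 := (hd.comp_tendsto hinv).norm_left
    have h2 := h1.tendsto_div_nhds_zero
    refine h2.congr fun n => ?_
    simp [hr, mul_comm, div_eq_mul_inv, -mul_eq_mul_left_iff, -mul_eq_mul_right_iff]
  have hlim : Tendsto (fun n : ℕ => (1 + ((n : ℝ)⁻¹ * c + (n : ℝ)⁻¹ ^ 2 * M ^ 2 / 2 + r n)) ^ n)
      atTop (𝓝 (Real.exp c)) := by
    apply Real.tendsto_one_add_pow_exp_of_tendsto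
    have h1 : Tendsto (fun n : ℕ => c + (n : ℝ)⁻¹ * (M ^ 2 / 2) + (n : ℝ) * r n) atTop
        (𝓝 (c + 0 * (M ^ 2 / 2) + 0)) := (tendsto_const_nhds.add (hinv.mul_const _)).add hrlim
    rw [zero_mul, add_zero, add_zero] at h1
    refine h1.congr' ?_
    filter_upwards [eventually_gt_atTop 0] with n hn
    have : (n : ℝ) ≠ 0 := by positivity
    field_simp
  refine ge_of_tendsto hlim ?_
  have hpos : ∀ᶠ n : ℕ in atTop, 0 < 1 + ((n : ℝ)⁻¹ * c + (n : ℝ)⁻¹ ^ 2 * M ^ 2 / 2) := by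
    have : Tendsto (fun n : ℕ => 1 + ((n : ℝ)⁻¹ * c + (n : ℝ)⁻¹ ^ 2 * M ^ 2 / 2)) atTop
        (𝓝 (1 + (0 * c + 0 ^ 2 * M ^ 2 / 2))) :=
      tendsto_const_nhds.add ((hinv.mul_const _).add (((hinv.pow 2).mul_const _).div_const _))
    exact this.eventually_const_lt (by simp)
  filter_upwards [eventually_gt_atTop 0, hpos] with n hn hn'
  have hn0 : (n : ℝ) ≠ 0 := by exact_mod_cast hn.ne'
  set x : C := (n : ℝ)⁻¹ • f with hx
  have hfx : f = n • x := by
    rw [hx, ← Nat.cast_smul_eq_nsmul ℝ, smul_smul]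
    simp [hn0]
  have hpow : NormedSpace.exp f = NormedSpace.exp x ^ n := by
    conv_lhs => rw [hfx]
    let := NormedAlgebra.restrictScalars ℚ ℂ C
    exact NormedSpace.exp_nsmul n x
  have hxle : ‖NormedSpace.exp x‖ ≤ 1 + ((n : ℝ)⁻¹ * c + (n : ℝ)⁻¹ ^ 2 * M ^ 2 / 2 + r n) := by
    have h1 : NormedSpace.exp x = (1 + x) + (NormedSpace.exp x - 1 - x) := by abel
    rw [h1]
    refine (norm_add_le _ _).trans ?_
    have h2 := hone (n : ℝ)⁻¹ (by positivity) hn'.le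
    linarith
  rw [hpow]
  exact (norm_pow_le' _ hn).trans (pow_le_pow_left₀ (norm_nonneg _) hxle n)

section States

/-! ### States -/

variable {B : Type u} [CStarAlgebra B]

theorem apply_algebraMap_of_mem_stateSpace {φ : B →L[ℂ] ℂ} (hφ : φ ∈ stateSpace B) (r : ℝ) :
    φ (algebraMap ℝ B r) = r := by
  have : algebraMap ℝ B r = (r : ℂ) • (1 : B) := by
    rw [Algebra.algebraMap_eq_smul_one]; simp
  rw [this, map_smul, hφ.2]; simp

variable [PartialOrder B] [StarOrderedRing B]

theorem apply_star_of_mem_stateSpace {φ : B →L[ℂ] ℂ} (hφ : φ ∈ stateSpace B) (b : B) :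
    φ (star b) = star (φ b) :=
  map_star (toPositive φ hφ) b

theorem re_apply_mono_of_mem_stateSpace {φ : B →L[ℂ] ℂ} (hφ : φ ∈ stateSpace B) {a b : B}
    (h : a ≤ b) : (φ a).re ≤ (φ b).re := by
  have := (Complex.nonneg_iff.1 (nonneg_of_mem_stateSpace hφ (sub_nonneg.2 h))).1
  rw [map_sub, Complex.sub_re] at this
  linarith

/-- Convexity of `t ↦ ψ (e^{ta*} e^{ta})` bounds its value at `1` from below by its tangent line
at `0`. -/
theorem IsConvexOver.one_add_le {X : Set B} {ψ : B →L[ℂ] ℂ} (hψ : ψ ∈ stateSpace B)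
    (hconv : IsConvexOver X ψ) {a : B} (ha : a ∈ X) :
    1 + 2 * (ψ a).re ≤ (ψ (star (NormedSpace.exp a) * NormedSpace.exp a)).re := by
  have hd1 := hasDerivAt_exp_real_smul_zero (star a)
  have hd2 := hasDerivAt_exp_real_smul_zero a
  have hd3 := (Complex.reCLM.hasFDerivAt.comp_hasDerivAt (0 : ℝ)
    ((ψ.restrictScalars ℝ).hasFDerivAt.comp_hasDerivAt (0 : ℝ) (hd1.mul hd2)))
  have hc := hconv a ha
  simp_rw [Complex.coe_smul] at hc
  have h := hc.le_slope_of_hasDerivAt (x := 0) (y := 1) (by simp) (by simp) one_pos hd3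
  simp [slope, apply_star_of_mem_stateSpace hψ, hψ.2] at h
  rw [NormedSpace.star_exp]
  linarith

/-! ### Approximation from below in a subalgebra -/

/-- If `φ` is determined by its values on the subalgebra `A`, then every self-adjoint `G`
dominates elements `f + f*` with `f ∈ A` at which `φ` almost takes the value `φ G`. Otherwise
some `c < φ G` bounds all values `φ (f + f*)` with `f ∈ A` and `f + f* ≤ G`, so `φ` is
non-negative on the elements of `A` whose real part lies in the cone generated by `c - G` and the
positive elements; the M. Riesz extension theorem then gives a state `ψ` with `ψ = φ` on `A` and
`ψ G ≤ c < φ G`. -/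
theorem HasUniqueStateExtension.exists_add_star_le {A : Subalgebra ℂ B} {φ : B →L[ℂ] ℂ}
    (hφ : φ ∈ stateSpace B) (hext : HasUniqueStateExtension (A : Set B) φ) {G : B}
    (hG : IsSelfAdjoint G) {ε : ℝ} (hε : 0 < ε) :
    ∃ f ∈ A, f + star f ≤ G ∧ (φ G).re - ε ≤ 2 * (φ f).re := by
  by_contra! hno
  set c : ℝ := (φ G).re - ε with hc
  -- elements of `B` whose real part lies in the cone generated by `c - G` and the positive elements
  let S : PointedCone ℝ B :=
    { carrier := {x | ∃ t : ℝ, 0 ≤ t ∧ t • (algebraMap ℝ B c - G) ≤ x + star x}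
      add_mem' := by
        rintro x y ⟨t, ht, hx⟩ ⟨s, hs, hy⟩
        refine ⟨t + s, add_nonneg ht hs, ?_⟩
        rw [add_smul, star_add, add_add_add_comm]
        exact add_le_add hx hy
      zero_mem' := ⟨0, le_rfl, by simp⟩
      smul_mem' := by
        rintro ⟨r, hr⟩ x ⟨t, ht, hx⟩
        refine ⟨r * t, mul_nonneg hr ht, ?_⟩
        have h1 := smul_le_smul_of_nonneg_left hx hr
        have h2 : (⟨r, hr⟩ : {r : ℝ // 0 ≤ r}) • x = r • x := rfl
        rw [h2, mul_smul, star_smul, star_trivial, ← smul_add]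
        exact h1 }
  have hS : ∀ x, x ∈ S ↔ ∃ t : ℝ, 0 ≤ t ∧ t • (algebraMap ℝ B c - G) ≤ x + star x :=
    fun x => Iff.rfl
  have hSnorm : ∀ x : B, algebraMap ℝ B ‖x‖ - x ∈ S := by
    intro x
    refine (hS _).2 ⟨0, le_rfl, ?_⟩
    have h1 : x + star x ≤ algebraMap ℝ B ‖x + star x‖ :=
      (IsSelfAdjoint.add_star_self x).le_algebraMap_norm_self
    have h2 : ‖x + star x‖ ≤ ‖x‖ + ‖x‖ := by
      simpa using norm_add_le x (star x)
    have h3 := h1.trans (algebraMap_mono B h2)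
    have h4 : star (algebraMap ℝ B ‖x‖) = algebraMap ℝ B ‖x‖ := by
      rw [← algebraMap_star_comm, star_trivial]
    rw [star_sub, h4, zero_smul, sub_add_sub_comm, ← map_add]
    exact sub_nonneg.2 h3
  let D : B →ₗ.[ℝ] ℝ :=
    { domain := (Subalgebra.toSubmodule A).restrictScalars ℝ
      toFun := (Complex.reLm ∘ₗ (φ : B →ₗ[ℂ] ℂ).restrictScalars ℝ).domRestrict _ }
  have hDapp : ∀ x : D.domain, D x = (φ (x : B)).re := fun x => rfl
  have hDnonneg : ∀ x : D.domain, (x : B) ∈ S → 0 ≤ D x := by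
    rintro ⟨x, hx⟩ hxS
    have hxA : x ∈ A := hx
    rw [hDapp]
    obtain ⟨t, ht, hle⟩ := (hS _).1 hxS
    change t • (algebraMap ℝ B c - G) ≤ x + star x at hle
    change 0 ≤ (φ x).re
    rcases ht.eq_or_lt with rfl | ht
    · have := re_apply_mono_of_mem_stateSpace hφ hle
      simp [apply_star_of_mem_stateSpace hφ] at this
      linarith
    · -- the test element `c / 2 - x / t` of `A`, whose double real part lies below `G`
      set f : B := algebraMap ℝ B (c / 2) - t⁻¹ • x with hf
      have hfA : f ∈ A := by
        refine A.sub_mem ?_ ?_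
        · rw [IsScalarTower.algebraMap_apply ℝ ℂ B]
          exact A.algebraMap_mem _
        · rw [← Complex.coe_smul]
          exact A.smul_mem hxA _
      have h4 : star (algebraMap ℝ B (c / 2)) = algebraMap ℝ B (c / 2) := by
        rw [← algebraMap_star_comm, star_trivial]
      have hfG : f + star f ≤ G := by
        have h1 := smul_le_smul_of_nonneg_left hle (inv_nonneg.2 ht.le)
        rw [smul_smul, inv_mul_cancel₀ ht.ne', one_smul, smul_add] at h1
        have h2 : f + star f = algebraMap ℝ B c - (t⁻¹ • x + t⁻¹ • star x) := by
          rw [hf, star_sub, h4, star_smul, star_trivial, sub_add_sub_comm, ← map_add, add_halves]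
        rw [h2]
        exact sub_le_comm.1 h1
      have h5 := hno f hfA hfG
      have h6 : (φ f).re = c / 2 - t⁻¹ * (φ x).re := by
        rw [hf, map_sub, apply_algebraMap_of_mem_stateSpace hφ, ← Complex.coe_smul, map_smul,
          smul_eq_mul, Complex.sub_re, Complex.ofReal_re, Complex.re_ofReal_mul]
      rw [h6] at h5
      have h7 : 0 < t⁻¹ * (φ x).re := by linarith
      exact (pos_of_mul_pos_right h7 (inv_nonneg.2 ht.le)).le
  have hDdense : ∀ y : B, ∃ x : D.domain, (x : B) + y ∈ S := by
    intro y
    refine ⟨⟨algebraMap ℝ B ‖y‖, ?_⟩, ?_⟩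
    · change algebraMap ℝ B ‖y‖ ∈ A
      rw [IsScalarTower.algebraMap_apply ℝ ℂ B]
      exact A.algebraMap_mem _
    · have := hSnorm (-y)
      rwa [norm_neg, sub_neg_eq_add] at this
  obtain ⟨g, hgD, hgS⟩ := riesz_extension S D hDnonneg hDdense
  have hgA : ∀ x ∈ A, g x = (φ x).re := fun x hx => hgD ⟨x, hx⟩
  have hgreal : ∀ r : ℝ, g (algebraMap ℝ B r) = r := by
    intro r
    rw [hgA, apply_algebraMap_of_mem_stateSpace hφ, Complex.ofReal_re]
    rw [IsScalarTower.algebraMap_apply ℝ ℂ B]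
    exact A.algebraMap_mem _
  have hgle : ∀ x, g x ≤ ‖x‖ := by
    intro x
    have := hgS _ (hSnorm x)
    rw [map_sub, hgreal] at this
    linarith
  have hgabs : ∀ x, |g x| ≤ normSeminorm ℂ B x := by
    intro x
    refine abs_le.2 ⟨?_, hgle x⟩
    have := hgle (-x)
    rw [map_neg, norm_neg] at this
    exact neg_le.1 this
  have hbound : ∀ x, ‖(Module.Dual.extendRCLike g x : ℂ)‖ ≤ 1 * ‖x‖ := fun x => by
    simpa using Module.Dual.norm_extendRCLike_le_seminorm g hgabs x
  set ψ : B →L[ℂ] ℂ := (Module.Dual.extendRCLike g).mkContinuous 1 hbound with hψ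
  have hψre : ∀ x, (ψ x).re = g x := fun x => Module.Dual.re_extendRCLike_apply (𝕜 := ℂ) g x
  have hψim : ∀ x, (ψ x).im = - g (Complex.I • x) := fun x =>
    Module.Dual.im_extendRCLike_apply (𝕜 := ℂ) g x
  have hψA : ∀ x ∈ A, ψ x = φ x := by
    intro x hx
    refine Complex.ext ?_ ?_
    · rw [hψre, hgA x hx]
    · rw [hψim, hgA _ (A.smul_mem hx _)]
      simp
  have hψφ : ψ = φ := by
    refine hext ψ ⟨LinearMap.mkContinuous_norm_le _ zero_le_one _, ?_⟩ hψA
    rw [hψA 1 A.one_mem, hφ.2]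
  have hcG : algebraMap ℝ B c - G ∈ S := by
    refine (hS _).2 ⟨2, zero_le_two, ?_⟩
    rw [star_sub, hG.star_eq, ← algebraMap_star_comm, star_trivial, two_smul]
  have h1 := hgS _ hcG
  rw [map_sub, hgreal, ← hψre, hψφ] at h1
  linarith

end States

/-! ### Closed sets of the spectrum and ideals -/

section Spectrum

theorem isClosed_spec_iff {B : Type u} [CStarAlgebra B] {K : Set (Spec B)} :
    IsClosed K ↔ hullKer K ⊆ K := by
  rw [← isOpen_compl_iff]
  change hullKer Kᶜᶜ ⊆ Kᶜᶜ ↔ _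
  rw [compl_compl]

/-- An ideal on which an irreducible representation does not vanish moves any nonzero vector `ξ`
to a dense subspace; here the ideal is the intersection of the kernels of the points of `K`. -/
theorem exists_norm_sub_lt {B : Type u} [CStarAlgebra B] {K : Set (Spec B)} {σ : IrrRep B}
    (hσ : Spec.mk σ ∉ hullKer K) {ξ : σ.H} (hξ : ξ ≠ 0) {δ : ℝ} (hδ : 0 < δ) :
    ∃ j : B, (∀ π : IrrRep B, Spec.mk π ∈ K → π.rep j = 0) ∧ ‖σ.rep j ξ - ξ‖ < δ := by
  obtain ⟨b, hbK, hbσ⟩ := Set.not_subset.1 hσ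
  have hbK' : ∀ π : IrrRep B, Spec.mk π ∈ K → π.rep b = 0 := by
    intro π hπ
    simp only [Set.mem_iInter] at hbK
    exact hbK _ hπ
  have hbσ' : σ.rep b ≠ 0 := hbσ
  let J : Submodule ℂ B :=
    { carrier := {j | ∀ π : IrrRep B, Spec.mk π ∈ K → π.rep j = 0}
      add_mem' := fun {x y} hx hy π hπ => by rw [map_add, hx π hπ, hy π hπ, add_zero]
      zero_mem' := fun π _ => map_zero _
      smul_mem' := fun c x hx π hπ => by rw [map_smul, hx π hπ, smul_zero] }
  have hJ : ∀ j, j ∈ J ↔ ∀ π : IrrRep B, Spec.mk π ∈ K → π.rep j = 0 := fun j => Iff.rfl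
  have hJl : ∀ a : B, ∀ j ∈ J, a * j ∈ J := fun a j hj π hπ => by
    rw [map_mul, (hJ j).1 hj π hπ, mul_zero]
  have hJr : ∀ a : B, ∀ j ∈ J, j * a ∈ J := fun a j hj π hπ => by
    rw [map_mul, (hJ j).1 hj π hπ, zero_mul]
  -- the vectors killed by `J` form a proper closed invariant subspace
  have hW : ∃ j ∈ J, σ.rep j ξ ≠ 0 := by
    by_contra! hno
    let W : Submodule ℂ σ.H := ⨅ j : J, (σ.rep (j : B)).ker
    have hWmem : ∀ v, v ∈ W ↔ ∀ j ∈ J, σ.rep j v = 0 := by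
      intro v
      simp [W, Submodule.mem_iInf]
    have hWclosed : IsClosed (W : Set σ.H) := by
      simp only [W, Submodule.coe_iInf]
      exact isClosed_iInter fun j => (σ.rep (j : B)).isClosed_ker
    rcases σ.irreducible.2 W hWclosed (fun a v hv => (hWmem _).2 fun j hj => by
      have := (hWmem v).1 hv _ (hJr a j hj)
      simpa using this) with h | h
    · exact hξ ((Submodule.mem_bot ℂ).1 (h ▸ (hWmem ξ).2 hno))
    · refine hbσ' (ContinuousLinearMap.ext fun v => ?_)
      exact (hWmem v).1 (h ▸ Submodule.mem_top) b hbK'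
  let T : B →ₗ[ℂ] σ.H :=
    { toFun := fun b => σ.rep b ξ
      map_add' := fun a b => by simp
      map_smul' := fun c b => by simp }
  have hTapp : ∀ b, T b = σ.rep b ξ := fun b => rfl
  let V : Submodule ℂ σ.H := (J.map T).topologicalClosure
  have hVinv : ∀ a : B, ∀ v ∈ V, σ.rep a v ∈ V := by
    intro a v hv
    have hmaps : Set.MapsTo (σ.rep a) (J.map T : Set σ.H) (J.map T : Set σ.H) := by
      rintro _ ⟨j, hj, rfl⟩
      exact ⟨a * j, hJl a j hj, by simp [hTapp]⟩
    exact hmaps.closure (σ.rep a).continuous hv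
  have hVtop : V = ⊤ := by
    refine (σ.irreducible.2 V (Submodule.isClosed_topologicalClosure _) hVinv).resolve_left ?_
    intro h
    obtain ⟨j, hj, hjξ⟩ := hW
    have : σ.rep j ξ ∈ V := Submodule.le_topologicalClosure _ ⟨j, hj, rfl⟩
    rw [h] at this
    exact hjξ ((Submodule.mem_bot ℂ).1 this)
  have hξV : ξ ∈ closure (J.map T : Set σ.H) := by
    have : ξ ∈ V := hVtop ▸ Submodule.mem_top
    exact this
  obtain ⟨_, ⟨j, hj, rfl⟩, hdist⟩ := Metric.mem_closure_iff.1 hξV δ hδ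
  refine ⟨j, hj, ?_⟩
  rwa [← dist_eq_norm, dist_comm]

end Spectrum

end CStarSpec

/-! ### Peaking elements -/

theorem theoremT {B : Type u} [CStarAlgebra B] [PartialOrder B] [StarOrderedRing B]
    (A : Subalgebra ℂ B) (hA : IsClosed (A : Set B))
    (ω : B →L[ℂ] ℂ) (hω : ω ∈ CStarSpec.pureStates B)
    (hext : CStarSpec.HasUniqueStateExtension (A : Set B) ω)
    (hconv : CStarSpec.IsConvexOver (A : Set B) ω)
    (K : Set (CStarSpec.Spec B)) (hK : IsClosed K) (hωK : CStarSpec.gnsClass ω hω ∉ K)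
    (α : ℝ) (hα : 0 < α) :
    ∃ a : A, IsUnit a ∧ ‖(a : B)‖ ≤ 1 + α ∧ ω (star (a : B) * (a : B)) = 1 ∧
      ∀ π : CStarSpec.IrrRep B, CStarSpec.Spec.mk π ∈ K → ‖π.rep (a : B)‖ < α := by
  have hs := hω.1
  -- the lower bound for `ω (e^{f*} e^f)` at which normalization costs a factor of at most `1 + α`
  set q : ℝ := ((1 + α) ^ 2)⁻¹ with hq
  have hq0 : 0 < q := by positivity
  have hq1 : q < 1 := inv_lt_one_of_one_lt₀ (by nlinarith)
  -- the depth of the well `G` on `K`, chosen so that `e^{-N} (1 + α) < α`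
  obtain ⟨N, hN0, hN⟩ : ∃ N : ℝ, 0 < N ∧ (1 + α) * Real.exp (-N) < α := by
    refine ⟨Real.log ((1 + α) / α) + 1, ?_, ?_⟩
    · have : 0 ≤ Real.log ((1 + α) / α) :=
        Real.log_nonneg ((one_le_div hα).2 (by linarith))
      linarith
    · have h1 : Real.exp (-Real.log ((1 + α) / α)) = α / (1 + α) := by
        rw [Real.exp_neg, Real.exp_log (by positivity), inv_div]
      have h2 : Real.exp (-(Real.log ((1 + α) / α) + 1)) < α / (1 + α) := by
        rw [← h1]; exact Real.exp_lt_exp.2 (by linarith)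
      rw [lt_div_iff₀ (by positivity)] at h2
      linarith
  let σ : CStarSpec.IrrRep B :=
    ⟨(CStarSpec.toPositive ω hs).GNS, CStarSpec.gnsRep ω hs, CStarSpec.gnsRep_irreducible hω⟩
  let ξ : σ.H := CStarSpec.gnsVector ω hs
  have hin : ∀ b, ⟪ξ, σ.rep b ξ⟫_ℂ = ω b := CStarSpec.inner_gnsVector ω hs
  have hξ : ξ ≠ 0 := by
    intro h
    have := hin 1
    rw [hs.2, h, inner_zero_left] at this
    exact zero_ne_one this
  have hσ : CStarSpec.Spec.mk σ ∉ CStarSpec.hullKer K :=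
    fun h => hωK (CStarSpec.isClosed_spec_iff.1 hK h)
  -- chosen so that `ω G = -2N ‖j ξ - ξ‖²` exceeds `-(1 - q) / 2`
  set δ : ℝ := Real.sqrt ((1 - q) / (4 * N)) with hδ
  have hδ0 : 0 < δ := Real.sqrt_pos.2 (div_pos (by linarith) (by positivity))
  obtain ⟨j, hjK, hj⟩ := CStarSpec.exists_norm_sub_lt hσ hξ hδ0
  set G : B := -((2 * N) • (star (1 - j) * (1 - j))) with hG
  have hGsa : IsSelfAdjoint G :=
    ((IsSelfAdjoint.all (2 * N)).smul (IsSelfAdjoint.star_mul_self _)).neg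
  have hGneg : G ≤ 0 :=
    neg_nonpos.2 (smul_nonneg (by positivity) (star_mul_self_nonneg _))
  have hωG : -((1 - q) / 2) ≤ (ω G).re := by
    have h1 : ω (star (1 - j) * (1 - j)) = ((‖σ.rep j ξ - ξ‖ ^ 2 : ℝ) : ℂ) := by
      rw [← hin, map_mul, map_star, ContinuousLinearMap.star_eq_adjoint,
        mul_apply_eq_comp, ContinuousLinearMap.adjoint_inner_right,
        inner_self_eq_norm_sq_to_K, map_sub, map_one, sub_apply,
        one_apply_eq_self, norm_sub_rev]
      simp
    have h2 : (ω G).re = -(2 * N * ‖σ.rep j ξ - ξ‖ ^ 2) := by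
      rw [hG, map_neg, ← Complex.coe_smul, map_smul, h1, smul_eq_mul, ← Complex.ofReal_mul,
        Complex.neg_re, Complex.ofReal_re]
    have h3 : ‖σ.rep j ξ - ξ‖ ^ 2 ≤ (1 - q) / (4 * N) := by
      rw [← Real.sq_sqrt (div_nonneg (by linarith : 0 ≤ 1 - q) (by positivity : 0 ≤ 4 * N))]
      exact pow_le_pow_left₀ (norm_nonneg _) hj.le 2
    rw [le_div_iff₀ (by positivity)] at h3
    rw [h2]
    linarith
  obtain ⟨f, hfA, hfG, hωf⟩ :=
    hext.exists_add_star_le hs hGsa (half_pos (sub_pos.2 hq1))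
  set h : ℝ := (ω (star (NormedSpace.exp f) * NormedSpace.exp f)).re with hh
  have hqh : q ≤ h := by
    have := hconv.one_add_le hs (a := f) hfA
    linarith
  have hh0 : 0 < h := hq0.trans_le hqh
  have hωexp : ω (star (NormedSpace.exp f) * NormedSpace.exp f) = (h : ℂ) :=
    Complex.ext rfl (by
      rw [CStarSpec.im_eq_zero_of_mem_stateSpace hs (IsSelfAdjoint.star_mul_self _),
        Complex.ofReal_im])
  set s : ℝ := (Real.sqrt h)⁻¹ with hsdef
  have hs0 : 0 < s := inv_pos.2 (Real.sqrt_pos.2 hh0)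
  have hsα : s ≤ 1 + α := by
    rw [hsdef]
    refine inv_le_of_inv_le₀ (by positivity) (Real.le_sqrt_of_sq_le ?_)
    rw [inv_pow]; exact hqh
  have hss : s * s * h = 1 := by
    rw [hsdef, ← mul_inv, Real.mul_self_sqrt hh0.le, inv_mul_cancel₀ hh0.ne']
  have hexpA : ∀ x ∈ A, NormedSpace.exp x ∈ A := fun x hx => by
    let := NormedAlgebra.restrictScalars ℚ ℂ B
    exact NormedSpace.exp_mem (R := ℂ) hA hx
  have hexpneg : NormedSpace.exp f * NormedSpace.exp (-f) = 1 ∧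
      NormedSpace.exp (-f) * NormedSpace.exp f = 1 := by
    let := NormedAlgebra.restrictScalars ℚ ℂ B
    constructor
    · rw [← NormedSpace.exp_add_of_commute (Commute.neg_right (Commute.refl f)), add_neg_cancel,
        NormedSpace.exp_zero]
    · rw [← NormedSpace.exp_add_of_commute (Commute.neg_left (Commute.refl f)), neg_add_cancel,
        NormedSpace.exp_zero]
  have hsC : (s : ℂ) ≠ 0 := by exact_mod_cast hs0.ne'
  have hnexp : ‖NormedSpace.exp f‖ ≤ 1 := by
    have : f + star f ≤ algebraMap ℝ B (2 * 0) := by simpa using hfG.trans hGneg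
    simpa using CStarSpec.norm_exp_le_of_add_star_le this
  refine ⟨⟨(s : ℂ) • NormedSpace.exp f, A.smul_mem (hexpA f hfA) _⟩, ?_, ?_, ?_, ?_⟩
  · refine isUnit_iff_exists.2
      ⟨⟨(s : ℂ)⁻¹ • NormedSpace.exp (-f), A.smul_mem (hexpA _ (A.neg_mem hfA)) _⟩,
        Subtype.ext ?_, Subtype.ext ?_⟩
    · change ((s : ℂ) • NormedSpace.exp f) * ((s : ℂ)⁻¹ • NormedSpace.exp (-f)) = 1
      rw [smul_mul_smul_comm, hexpneg.1, mul_inv_cancel₀ hsC, one_smul]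
    · change ((s : ℂ)⁻¹ • NormedSpace.exp (-f)) * ((s : ℂ) • NormedSpace.exp f) = 1
      rw [smul_mul_smul_comm, hexpneg.2, inv_mul_cancel₀ hsC, one_smul]
  · rw [norm_smul, Complex.norm_real, Real.norm_of_nonneg hs0.le]
    nlinarith
  · rw [star_smul, smul_mul_smul_comm, map_smul, hωexp, Complex.star_def, Complex.conj_ofReal,
      smul_eq_mul]
    exact_mod_cast hss
  · intro π hπ
    have hle : π.rep f + star (π.rep f) ≤ algebraMap ℝ (π.H →L[ℂ] π.H) (2 * (-N)) := by
      have h1 := OrderHomClass.mono π.rep hfG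
      have h2 : π.rep G = algebraMap ℝ (π.H →L[ℂ] π.H) (2 * (-N)) := by
        rw [hG, map_neg, ← Complex.coe_smul, map_smul, map_mul, map_star, map_sub, map_one,
          hjK π hπ, sub_zero, star_one, mul_one, Complex.coe_smul,
          Algebra.algebraMap_eq_smul_one, ← neg_smul]
        ring_nf
      rw [map_add, map_star] at h1
      exact h1.trans_eq h2
    have hexp : π.rep (NormedSpace.exp f) = NormedSpace.exp (π.rep f) := by
      let := NormedAlgebra.restrictScalars ℚ ℂ B
      let := Algebra.restrictScalars ℚ ℂ (π.H →L[ℂ] π.H)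
      exact NormedSpace.map_exp π.rep (map_continuous π.rep) f
    rw [map_smul, norm_smul, hexp, Complex.norm_real, Real.norm_of_nonneg hs0.le]
    have := CStarSpec.norm_exp_le_of_add_star_le hle
    calc s * ‖NormedSpace.exp (π.rep f)‖ ≤ (1 + α) * Real.exp (-N) :=
          mul_le_mul hsα this (norm_nonneg _) (by positivity)
      _ < α := hN
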